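/- All graphs are finite and simple. For a graph $G$, the TARS-graph $\varepsilon(G)$ is the graph whose vertices are the dominating sets of $G$ (the sets $D\subseteq V(G)$ such that every vertex of $V(G)\setminus D$ is adjacent to a vertex of $D$), where two dominating sets $X$ and $Y$ are adjacent if and only if either $Y$ is obtained from $X$ by adding or deleting a single vertex of $G$, or there are vertices $a\in X$ and $b\in Y\setminus X$, adjacent in $G$, such that $Y=(X\cup\{b\})\setminus\{a\}$. A graph on $n$ vertices is pancyclic if it contains a cycle of length $\ell$ for every integer $\ell$ with $3\le \ell\le n$. A graph $H'$ is obtained from a graph $H$ by Operation A if $H$ has distinct vertices $u,v,x$ with $N(u)=\{x,v\}$ and $N(v)=\{u\}$, and $H'=H-\{u,v\}$ (up to isomorphism). Theorem. Let $H'$ be a connected graph on at least $2$ vertices that is obtained from a graph $H$ by Operation A. If $\varepsilon(H')$ is pancyclic, then $\varepsilon(H)$ is pancyclic. -/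

import Mathlib

namespace SimpleGraph

/-- `D` is a dominating set of `G`: every vertex outside `D` is adjacent to some vertex of `D`. -/
def IsDominatingSet {V : Type*} (G : SimpleGraph V) (D : Set V) : Prop :=
  ∀ w, w ∉ D → ∃ d ∈ D, G.Adj w d

/-- Token addition/removal: `Y` is obtained from `X` by adding a vertex that is not in `X`, or by
deleting a vertex of `X`. -/
def TokenAddRemove {V : Type*} (X Y : Set V) : Prop :=
  (∃ w, w ∉ X ∧ Y = X ∪ {w}) ∨ (∃ w, w ∈ X ∧ Y = X \ {w})

/-- Token sliding: `Y` is obtained from `X` by exchanging some `u ∈ X` for a vertex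
`v ∈ Y \ X` adjacent to `u` in `G`. -/
def TokenSlide {V : Type*} (G : SimpleGraph V) (X Y : Set V) : Prop :=
  ∃ u v, u ∈ X ∧ v ∈ Y \ X ∧ G.Adj u v ∧ Y = (X ∪ {v}) \ {u}

theorem TokenAddRemove.symm {V : Type*} {X Y : Set V} (h : TokenAddRemove X Y) :
    TokenAddRemove Y X := by
  rcases h with ⟨w, hw, rfl⟩ | ⟨w, hw, rfl⟩
  · refine Or.inr ⟨w, by simp, ?_⟩
    ext z
    by_cases hz : z = w <;> simp_all
  · refine Or.inl ⟨w, by simp, ?_⟩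
    ext z
    by_cases hz : z = w <;> simp_all

theorem TokenAddRemove.ne {V : Type*} {X Y : Set V} (h : TokenAddRemove X Y) : X ≠ Y := by
  rintro rfl
  rcases h with ⟨w, hw, h⟩ | ⟨w, hw, h⟩
  · exact hw (h ▸ Or.inr rfl)
  · rw [h] at hw
    exact hw.2 rfl

theorem TokenSlide.symm {V : Type*} {G : SimpleGraph V} {X Y : Set V} (h : G.TokenSlide X Y) :
    G.TokenSlide Y X := by
  obtain ⟨u, v, hu, ⟨hv, hvX⟩, huv, rfl⟩ := h
  refine ⟨v, u, hv, ⟨hu, fun hu' => hu'.2 rfl⟩, huv.symm, ?_⟩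
  have hne := huv.ne
  ext z
  by_cases hz : z = u <;> by_cases hz' : z = v <;> simp_all

theorem TokenSlide.ne {V : Type*} {G : SimpleGraph V} {X Y : Set V} (h : G.TokenSlide X Y) :
    X ≠ Y := by
  rintro rfl
  obtain ⟨u, v, hu, hv, -⟩ := h
  exact hv.2 hv.1

/-- The TARS-graph of the seed graph `G`: its vertices are the dominating sets of `G`, and two of
them are adjacent if one is obtained from the other by token addition/removal or by token
sliding. -/
def tarsGraph {V : Type*} (G : SimpleGraph V) : SimpleGraph {D : Set V // G.IsDominatingSet D} where
  Adj X Y := TokenAddRemove X.1 Y.1 ∨ G.TokenSlide X.1 Y.1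
  symm := ⟨fun _ _ h => h.imp TokenAddRemove.symm TokenSlide.symm⟩
  loopless := ⟨fun _ h => h.elim (fun h => h.ne rfl) (fun h => h.ne rfl)⟩

/-- A finite graph on `n` vertices is pancyclic if it has a cycle of length `l` for every integer
`l` with `3 ≤ l ≤ n`. -/
def IsPancyclic {V : Type*} [Finite V] (G : SimpleGraph V) : Prop :=
  ∀ l : ℕ, 3 ≤ l → l ≤ Nat.card V → ∃ (a : V) (p : G.Walk a a), p.IsCycle ∧ p.length = l

/-- `H'` is obtained from `H` by Operation A: `H` has distinct vertices `u`, `v`, `x` with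
`N(u) = {x, v}` and `N(v) = {u}`, and `H'` is (a copy of) `H - {u, v}`. -/
def IsOperationA {V W : Type*} (H : SimpleGraph V) (H' : SimpleGraph W) : Prop :=
  ∃ u v x : V, x ≠ v ∧ H.neighborSet u = {x, v} ∧ H.neighborSet v = {u} ∧
    Nonempty (H' ≃g H.induce ({u, v}ᶜ : Set V))

end SimpleGraph

/-! Let `x - u - v` be the path that `H'` lacks. A dominating set of `H` meets `{u, v}`, and its
trace `E` on `H'` either is dominating, or dominates all vertices but `x` and comes with `u`. The
sets of the first kind span the product of `ε(H')` with a triangle, whose corners are the traces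
`{u, v}`, `{u}` and `{v}` on the path. Those of the second kind come in pairs: if `E` dominates all
but `x`, then `c = E ∪ {x}` is dominating, and the two sets over `E` form an outer edge next to the
two triangle corners over `c` that contain `u`. Sliding the token at `u` to `x` joins one end of the
outer edge to the third corner.

A path with `k` vertices in `ε(H')` lifts to a cycle that goes out along the corners `{u, v}` and
`{u}` and comes back along `{v}`. It has `2 * k` vertices, one more for each vertex at which it
changes between the corners `{u, v}` and `{u}`, and a further two where it does so by an outer edge.
With `n` dominating sets of `H'`, `s` of them next to an outer edge, initial segments of a
Hamiltonian path give all lengths up to `3 * n`, and outer edges give the lengths `3 * n + 2 * m`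
for `m ≤ s`. The lengths `3 * n + 2 * m + 1` for `m < s` are reached by starting the path at a `c`
next to an outer edge and closing the cycle by the slide from `u` to `x`. The number of dominating
sets is never two, so a pancyclic `ε(H')` has a Hamiltonian path from each vertex.
-/

namespace TarsGraph

open SimpleGraph

section Walks

variable {A : Type*} {G : SimpleGraph A}

theorem isPath_append_cons {a b c d : A} {p : G.Walk a b} {q : G.Walk c d} (hp : p.IsPath)
    (hq : q.IsPath) (h : G.Adj b c) (hpq : p.support.Disjoint q.support) :
    (p.append (.cons h q)).IsPath := by
  rw [Walk.isPath_def, Walk.support_append, Walk.support_cons, List.tail_cons]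
  exact hp.support_nodup.append hq.support_nodup hpq

theorem isCycle_cons_of_isPath {a b : A} {p : G.Walk a b} (hp : p.IsPath) (hlen : 2 ≤ p.length)
    (h : G.Adj b a) : (Walk.cons h p).IsCycle := by
  refine (p.cons_isCycle_iff h).2 ⟨hp, fun hmem => ?_⟩
  have := hp.length_eq_one_of_mem_edges (Sym2.eq_swap ▸ hmem)
  omega

/-- A graph is homogeneously traceable if every vertex is an end of a Hamiltonian path. The path is
described without the decidable equality required by `SimpleGraph.Walk.IsHamiltonian`. -/
def IsHomogeneouslyTraceable (G : SimpleGraph A) : Prop :=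
  ∀ a, ∃ (b : A) (p : G.Walk a b), p.IsPath ∧ ∀ c, c ∈ p.support

theorem length_add_one_eq_card {a b : A} {p : G.Walk a b} (hp : p.IsPath)
    (hall : ∀ c, c ∈ p.support) : p.length + 1 = Nat.card A := by
  classical
  have hham := hp.isHamiltonian_of_mem hall
  have := hham.fintype
  rw [← p.length_support, hham.length_support, Nat.card_eq_fintype_card]

theorem isHomogeneouslyTraceable_of_isCycle [Finite A] {a : A} {p : G.Walk a a} (hp : p.IsCycle)
    (hlen : p.length = Nat.card A) : IsHomogeneouslyTraceable G := by
  classical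
  have := Fintype.ofFinite A
  intro c
  have hham : p.IsHamiltonianCycle :=
    Walk.isHamiltonianCycle_iff_isCycle_and_length_eq.2
      ⟨hp, hlen.trans Nat.card_eq_fintype_card⟩
  have hrot := (hham.rotate (hham.mem_support c)).isHamiltonian_tail
  refine ⟨_, _, hrot.isPath.reverse, fun d => ?_⟩
  rw [Walk.support_reverse, List.mem_reverse]
  exact hrot.mem_support d

theorem isHomogeneouslyTraceable_of_isPancyclic [Finite A] (hG : G.IsPancyclic)
    (hcard : Nat.card A ≠ 2) : IsHomogeneouslyTraceable G := by
  by_cases hle : 3 ≤ Nat.card A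
  · obtain ⟨a, p, hp, hlen⟩ := hG _ hle le_rfl
    exact isHomogeneouslyTraceable_of_isCycle hp hlen
  · have : Subsingleton A := Finite.card_le_one_iff_subsingleton.1 (by omega)
    exact fun a => ⟨a, .nil, .nil, fun c => by simp [Subsingleton.elim c a]⟩

theorem isPancyclic_of_bijective {B : Type*} [Finite A] [Finite B] {M : SimpleGraph B} (f : G →g M)
    (hf : Function.Bijective f) (hG : G.IsPancyclic) : M.IsPancyclic := by
  intro l h3 hl
  rw [← Nat.card_eq_of_bijective f hf] at hl
  obtain ⟨a, p, hp, rfl⟩ := hG l h3 hl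
  exact ⟨_, p.map f, hp.map hf.injective, p.length_map f⟩

end Walks

theorem sum_map_add_ite_mem {A : Type*} [DecidableEq A] {l : List A} (hl : l.Nodup) {T : Finset A}
    (hT : T ⊆ l.toFinset) (m n : ℕ) :
    (l.map fun c => m + if c ∈ T then n else 0).sum = m * l.length + n * T.card := by
  rw [← List.sum_toFinset _ hl, Finset.sum_add_distrib, Finset.sum_ite_mem,
    Finset.inter_eq_right.2 hT]
  simp [List.toFinset_card_of_nodup hl, mul_comm]

theorem exists_finset_subset_card_eq {A : Type*} {S : Set A} (hS : S.Finite) {m : ℕ}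
    (hm : m ≤ S.ncard) : ∃ T : Finset A, ↑T ⊆ S ∧ T.card = m := by
  rw [Set.ncard_eq_toFinset_card S hS] at hm
  obtain ⟨T, hT, hcard⟩ := Finset.exists_subset_card_eq hm
  exact ⟨T, fun c hc => hS.mem_toFinset.1 (hT hc), hcard⟩

/-- The vertices of the expansion of a graph on `A` along `S`: over each `c : A` a triangle, with
the sides `some true` and `some false` and the apex `none`, and over each `c : S` moreover an
outer edge, with one end next to each side. -/
abbrev Expansion {A : Type*} (S : Set A) : Type _ := (A × Option Bool) ⊕ (S × Bool)

namespace Expansion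

variable {A : Type*} {G : SimpleGraph A} {S : Set A}

/-- The vertex of `A` over which a vertex of the expansion lies. -/
def base : Expansion S → A :=
  Sum.elim (fun y => y.1) (fun y => y.1)

variable (G S) in
/-- The edges of the expansion of `G` along `S`, each in one direction. The edge `outer_apex`
has no counterpart at the side `some false`. -/
inductive Rel : Expansion S → Expansion S → Prop
  | sides (c : A) : Rel (.inl (c, some true)) (.inl (c, some false))
  | apex (c : A) (s : Bool) : Rel (.inl (c, some s)) (.inl (c, none))
  | layer {c d : A} (h : G.Adj c d) (k : Option Bool) : Rel (.inl (c, k)) (.inl (d, k))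
  | outer (c : S) : Rel (.inr (c, true)) (.inr (c, false))
  | outer_side (c : S) (s : Bool) : Rel (.inl (c, some s)) (.inr (c, s))
  | outer_apex (c : S) : Rel (.inr (c, true)) (.inl (c, none))

variable (G S) in
/-- The expansion of `G` along `S`: the product of `G` with a triangle, together with an outer edge
over each vertex of `S`. -/
def graph : SimpleGraph (Expansion S) :=
  .fromRel (Rel G S)

theorem Rel.ne {y z : Expansion S} (h : Rel G S y z) : y ≠ z := by
  rintro rfl
  cases h with
  | layer h => exact h.ne rfl

theorem Rel.adj {y z : Expansion S} (h : Rel G S y z) : (graph G S).Adj y z :=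
  (SimpleGraph.fromRel_adj _ _ _).2 ⟨h.ne, .inl h⟩

variable (S) in
theorem adj_sides (c : A) (s : Bool) :
    (graph G S).Adj (.inl (c, some s)) (.inl (c, some !s)) := by
  cases s
  exacts [(Rel.sides c).adj.symm, (Rel.sides c).adj]

theorem adj_outer (c : S) (s : Bool) : (graph G S).Adj (.inr (c, s)) (.inr (c, !s)) := by
  cases s
  exacts [(Rel.outer c).adj.symm, (Rel.outer c).adj]

/-- A hom out of the expansion need only be checked on one direction of each edge. -/
def lift {B : Type*} {M : SimpleGraph B} (f : Expansion S → B)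
    (hf : ∀ {y z}, Rel G S y z → M.Adj (f y) (f z)) : graph G S →g M where
  toFun := f
  map_rel' h := ((SimpleGraph.fromRel_adj _ _ _).1 h).2.elim hf fun h => (hf h).symm

/-- `n c` is, for each `c`, the length of a path over `c` from side to side that avoids the apex: it
stays at a side, crosses over, or, if `c ∈ S`, makes a detour along the outer edge. -/
def IsAdmissible (S : Set A) (n : A → ℕ) : Prop :=
  ∀ c, n c ≤ 1 ∨ n c = 3 ∧ c ∈ S

theorem IsAdmissible.exists_sidePath {n : A → ℕ} (hn : IsAdmissible S n) (c : A) (s : Bool) :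
    ∃ (t : Bool) (p : (graph G S).Walk (.inl (c, some s)) (.inl (c, some t))),
      p.IsPath ∧ p.length = n c ∧ .inl (c, none) ∉ p.support ∧
        ∀ y ∈ p.support, y.base = c ∧ (y.isRight → n c = 3) := by
  rcases hn c with h | ⟨h, hc⟩
  · rcases Nat.le_one_iff_eq_zero_or_eq_one.1 h with h | h
    · exact ⟨s, .nil, by simp [h, base]⟩
    · exact ⟨!s, (adj_sides S c s).toWalk, by simp [h, base]⟩
  · exact ⟨!s, .cons (Rel.outer_side ⟨c, hc⟩ s).adj
      (.cons (adj_outer ⟨c, hc⟩ s) (Rel.outer_side ⟨c, hc⟩ !s).adj.symm.toWalk),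
      by simp [h, base]⟩

/-- The lift of a path of `G`: it walks out along the sides, with `n c` edges over each vertex `c`,
and back along the apices. -/
theorem IsAdmissible.exists_loop {n : A → ℕ} (hn : IsAdmissible S n) {c d : A} (q : G.Walk c d)
    (hq : q.IsPath) (s : Bool) :
    ∃ p : (graph G S).Walk (.inl (c, some s)) (.inl (c, none)),
      p.IsPath ∧ p.length + 1 = (q.support.map fun a => 2 + n a).sum ∧
        ∀ y ∈ p.support, y.base ∈ q.support ∧ (y.isRight → n y.base = 3) := by
  induction q generalizing s with
  | @nil c =>
    obtain ⟨t, p, hp, hlen, hapex, hmem⟩ := hn.exists_sidePath (G := G) c s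
    refine ⟨p.concat (Rel.apex c t).adj, hp.concat hapex _, ?_, ?_⟩
    · rw [Walk.length_concat, hlen, Walk.support_nil, List.map_singleton, List.sum_singleton]
      ring
    intro y hy
    rw [Walk.support_concat, List.mem_append, List.mem_singleton] at hy
    rcases hy with hy | rfl
    · obtain ⟨hbase, hright⟩ := hmem y hy
      simpa [hbase] using hright
    · simp [base]
  | @cons c e d h q ih =>
    obtain ⟨t, p, hp, hlen, hapex, hmem⟩ := hn.exists_sidePath (G := G) c s
    obtain ⟨hq, hc⟩ := (Walk.cons_isPath_iff h q).1 hq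
    obtain ⟨r, hr, hrlen, hrmem⟩ := ih hq t
    have hback : (r.concat (Rel.layer h.symm none).adj).IsPath :=
      hr.concat (fun hmem => hc (hrmem (.inl (c, none)) hmem).1) _
    refine ⟨p.append (.cons (Rel.layer h (some t)).adj (r.concat (Rel.layer h.symm none).adj)),
      isPath_append_cons hp hback _ fun y hy hy' => ?_, ?_, fun y hy => ?_⟩
    · rw [Walk.support_concat, List.mem_append, List.mem_singleton] at hy'
      rcases hy' with hy' | rfl
      · exact hc ((hmem y hy).1 ▸ (hrmem y hy').1)
      · exact hapex hy
    · rw [Walk.length_append, Walk.length_cons, Walk.length_concat, hlen, Walk.support_cons,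
        List.map_cons, List.sum_cons, ← hrlen]
      ring
    · rw [Walk.support_append, Walk.support_cons, List.tail_cons, Walk.support_concat,
        List.mem_append, List.mem_append, List.mem_singleton] at hy
      rcases hy with hy | hy | rfl
      · obtain ⟨hbase, hright⟩ := hmem y hy
        simpa [hbase] using hright
      · exact ⟨List.mem_cons_of_mem _ (hrmem y hy).1, (hrmem y hy).2⟩
      · simp [base]

theorem IsAdmissible.exists_isCycle {n : A → ℕ} (hn : IsAdmissible S n) {c d : A}
    {q : G.Walk c d} (hq : q.IsPath) {l : ℕ} (hl : 3 ≤ l)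
    (hsum : (q.support.map fun a => 2 + n a).sum = l) :
    ∃ (y : Expansion S) (p : (graph G S).Walk y y), p.IsCycle ∧ p.length = l := by
  obtain ⟨p, hp, hlen, -⟩ := hn.exists_loop q hq true
  exact ⟨_, .cons (Rel.apex c true).adj.symm p, isCycle_cons_of_isPath hp (by omega) _,
    hlen.trans hsum⟩

/-- The detour from the apex to the first side through an outer vertex adds one to the length. -/
theorem IsAdmissible.exists_isCycle_add_one {n : A → ℕ} (hn : IsAdmissible S n) {c d : A}
    {q : G.Walk c d} (hq : q.IsPath) (hc : c ∈ S) (hnc : n c ≠ 3) {l : ℕ} (hl : 2 ≤ l)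
    (hsum : (q.support.map fun a => 2 + n a).sum = l) :
    ∃ (y : Expansion S) (p : (graph G S).Walk y y), p.IsCycle ∧ p.length = l + 1 := by
  obtain ⟨p, hp, hlen, hmem⟩ := hn.exists_loop q hq true
  have hp' : (p.concat (Rel.outer_apex ⟨c, hc⟩).adj.symm).IsPath :=
    hp.concat (fun hout => hnc ((hmem (.inr (⟨c, hc⟩, true)) hout).2 rfl)) _
  exact ⟨_, .cons (Rel.outer_side ⟨c, hc⟩ true).adj.symm _,
    isCycle_cons_of_isPath hp' (by rw [Walk.length_concat]; omega) _,
    by rw [Walk.length_cons, Walk.length_concat, hlen, hsum]⟩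

theorem isAdmissible_ite_mem [DecidableEq A] (S : Set A) (T : Finset A) :
    IsAdmissible S fun c => if c ∈ T then 1 else 0 := by
  intro c
  dsimp only
  split_ifs <;> simp

theorem isAdmissible_one_add_ite_mem [DecidableEq A] {T : Finset A} (hT : ↑T ⊆ S) :
    IsAdmissible S fun c => 1 + if c ∈ T then 2 else 0 := by
  intro c
  dsimp only
  split_ifs with hc
  · exact .inr ⟨rfl, hT hc⟩
  · simp

theorem exists_isCycle_two_mul_add {c d : A} {q : G.Walk c d} (hq : q.IsPath) {m : ℕ}
    (hm : m ≤ q.length + 1) (h3 : 3 ≤ 2 * (q.length + 1) + m) :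
    ∃ (y : Expansion S) (p : (graph G S).Walk y y),
      p.IsCycle ∧ p.length = 2 * (q.length + 1) + m := by
  classical
  obtain ⟨T, hT, rfl⟩ := Finset.exists_subset_card_eq (s := q.support.toFinset) (n := m)
    (by rwa [List.toFinset_card_of_nodup hq.support_nodup, q.length_support])
  refine (isAdmissible_ite_mem S T).exists_isCycle hq h3 ?_
  rw [sum_map_add_ite_mem hq.support_nodup hT, q.length_support, one_mul]

theorem sum_map_two_add_one_add_ite_mem [DecidableEq A] {c d : A} {q : G.Walk c d} (hq : q.IsPath)
    {T : Finset A} (hT : T ⊆ q.support.toFinset) :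
    (q.support.map fun a => 2 + (1 + if a ∈ T then 2 else 0)).sum =
      3 * (q.length + 1) + 2 * T.card := by
  simp_rw [← add_assoc]
  rw [sum_map_add_ite_mem hq.support_nodup hT, q.length_support]

theorem exists_isCycle_three_mul_add [Finite A] {c d : A} {q : G.Walk c d} (hq : q.IsPath)
    (hall : ∀ a, a ∈ q.support) {m : ℕ} (hm : m ≤ S.ncard) :
    ∃ (y : Expansion S) (p : (graph G S).Walk y y),
      p.IsCycle ∧ p.length = 3 * Nat.card A + 2 * m := by
  classical
  obtain ⟨T, hTS, rfl⟩ := exists_finset_subset_card_eq S.toFinite hm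
  have hcard := length_add_one_eq_card hq hall
  refine (isAdmissible_one_add_ite_mem hTS).exists_isCycle hq (by omega) ?_
  rw [sum_map_two_add_one_add_ite_mem hq fun a _ => List.mem_toFinset.2 (hall a), hcard]

theorem exists_isCycle_three_mul_add_add_one [Finite A] {c d : A} {q : G.Walk c d} (hq : q.IsPath)
    (hall : ∀ a, a ∈ q.support) (hc : c ∈ S) {m : ℕ} (hm : m < S.ncard) :
    ∃ (y : Expansion S) (p : (graph G S).Walk y y),
      p.IsCycle ∧ p.length = 3 * Nat.card A + 2 * m + 1 := by
  classical
  obtain ⟨T, hTS, rfl⟩ := exists_finset_subset_card_eq (S \ {c}).toFinite (m := m)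
    (by rw [Set.ncard_sdiff_singleton_of_mem hc]; omega)
  have hcT : c ∉ T := fun hcT => (hTS hcT).2 rfl
  have hcard := length_add_one_eq_card hq hall
  refine (isAdmissible_one_add_ite_mem (hTS.trans Set.sdiff_subset)).exists_isCycle_add_one hq hc
    (by simp [hcT]) (by omega) ?_
  rw [sum_map_two_add_one_add_ite_mem hq fun a _ => List.mem_toFinset.2 (hall a), hcard]

theorem card_eq [Finite A] (S : Set A) :
    Nat.card (Expansion S) = 3 * Nat.card A + 2 * S.ncard := by
  simp only [Nat.card_sum, Nat.card_prod, Finite.card_option, Nat.card_eq_fintype_card (α := Bool),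
    Fintype.card_bool, Nat.card_coe_set_eq]
  ring

theorem isPancyclic_graph [Finite A] (hG : IsHomogeneouslyTraceable G) :
    (graph G S).IsPancyclic := by
  intro l h3 hl
  rw [card_eq] at hl
  have hA : 0 < Nat.card A := by
    have := Set.ncard_le_card S
    omega
  obtain ⟨a⟩ := (Nat.card_pos_iff.1 hA).1
  obtain ⟨b, q, hq, hall⟩ := hG a
  have hcard := length_add_one_eq_card hq hall
  by_cases hshort : l ≤ 3 * Nat.card A
  · obtain ⟨k, m, hk, hm, rfl⟩ :
        ∃ k m, k ≤ q.length ∧ m ≤ k + 1 ∧ 2 * (k + 1) + m = l := by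
      by_cases h : l ≤ 2 * Nat.card A
      · exact ⟨l / 2 - 1, l % 2, by omega, by omega, by omega⟩
      · exact ⟨q.length, l - 2 * Nat.card A, by omega, by omega, by omega⟩
    have hlen : (q.take k).length = k := by rw [q.take_length, min_eq_left hk]
    simpa only [hlen] using
      exists_isCycle_two_mul_add (S := S) (hq.take k) (m := m) (by omega) (by omega)
  obtain ⟨m, hm | hm⟩ := (l - 3 * Nat.card A).even_or_odd'
  · obtain rfl : l = 3 * Nat.card A + 2 * m := by omega
    exact exists_isCycle_three_mul_add hq hall (by omega)
  · obtain rfl : l = 3 * Nat.card A + 2 * m + 1 := by omega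
    have hmS : m < S.ncard := by omega
    obtain ⟨c, hc⟩ := Set.nonempty_of_ncard_ne_zero (by omega : S.ncard ≠ 0)
    obtain ⟨d, r, hr, hrall⟩ := hG c
    exact exists_isCycle_three_mul_add_add_one hr hrall hc hmS

end Expansion

section TokenMoves

variable {V W : Type*} {G : SimpleGraph V} {X Y Z : Set V}

theorem tokenAddRemove_union_right (h : TokenAddRemove X Y) (hX : Disjoint X Z)
    (hY : Disjoint Y Z) : TokenAddRemove (X ∪ Z) (Y ∪ Z) := by
  rcases h with ⟨w, hw, rfl⟩ | ⟨w, hw, rfl⟩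
  · have hwZ : w ∉ Z := Set.disjoint_left.1 hY (.inr rfl)
    exact .inl ⟨w, by simp [hw, hwZ], Set.union_right_comm _ _ _⟩
  · have hwZ : w ∉ Z := Set.disjoint_left.1 hX hw
    exact .inr ⟨w, .inl hw, by rw [Set.union_sdiff_distrib, Set.sdiff_singleton_eq_self hwZ]⟩

theorem tokenSlide_union_right (h : G.TokenSlide X Y) (hX : Disjoint X Z) (hY : Disjoint Y Z) :
    G.TokenSlide (X ∪ Z) (Y ∪ Z) := by
  obtain ⟨a, b, ha, hb, hab, rfl⟩ := h
  have haZ : a ∉ Z := Set.disjoint_left.1 hX ha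
  have hbZ : b ∉ Z := Set.disjoint_left.1 hY hb.1
  refine ⟨a, b, .inl ha, ⟨.inl hb.1, by simp [hb.2, hbZ]⟩, hab, ?_⟩
  rw [Set.union_right_comm, Set.union_sdiff_distrib (t := Z), Set.sdiff_singleton_eq_self haZ]

theorem tokenAddRemove_image {f : V → W} (hf : f.Injective) (h : TokenAddRemove X Y) :
    TokenAddRemove (f '' X) (f '' Y) := by
  rcases h with ⟨w, hw, rfl⟩ | ⟨w, hw, rfl⟩
  · exact .inl ⟨f w, by rwa [hf.mem_set_image], by rw [Set.image_union, Set.image_singleton]⟩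
  · exact .inr ⟨f w, Set.mem_image_of_mem f hw, by rw [Set.image_sdiff hf, Set.image_singleton]⟩

theorem tokenSlide_image {G' : SimpleGraph W} {f : G →g G'} (hf : Function.Injective f)
    (h : G.TokenSlide X Y) : G'.TokenSlide (f '' X) (f '' Y) := by
  obtain ⟨a, b, ha, hb, hab, rfl⟩ := h
  refine ⟨f a, f b, Set.mem_image_of_mem f ha, ?_, f.map_adj hab, ?_⟩
  · rw [← Set.image_sdiff hf]
    exact Set.mem_image_of_mem f hb
  · rw [Set.image_sdiff hf, Set.image_union, Set.image_singleton, Set.image_singleton]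

/-- The relation whose restriction to dominating sets is the adjacency of the TARS-graph. -/
def TarsMove (G : SimpleGraph V) (X Y : Set V) : Prop :=
  TokenAddRemove X Y ∨ G.TokenSlide X Y

theorem TarsMove.union_right (h : TarsMove G X Y) (hX : Disjoint X Z) (hY : Disjoint Y Z) :
    TarsMove G (X ∪ Z) (Y ∪ Z) :=
  h.imp (tokenAddRemove_union_right · hX hY) (tokenSlide_union_right · hX hY)

theorem TarsMove.image {G' : SimpleGraph W} {f : G →g G'} (hf : Function.Injective f)
    (h : TarsMove G X Y) : TarsMove G' (f '' X) (f '' Y) :=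
  h.imp (tokenAddRemove_image hf) (tokenSlide_image hf)

end TokenMoves

section Domination

variable {W : Type*} {G : SimpleGraph W}

variable (G) in
/-- The vertices that a set `E` fails to dominate. -/
def undominated (E : Set W) : Set W :=
  {w | w ∉ E ∧ ∀ d ∈ E, ¬ G.Adj w d}

theorem isDominatingSet_iff_undominated_eq_empty {E : Set W} :
    G.IsDominatingSet E ↔ undominated G E = ∅ := by
  simp [IsDominatingSet, undominated, Set.eq_empty_iff_forall_notMem]

variable (G) in
/-- The dominating sets `c` for which `x` is the only vertex that `c \ {x}` fails to dominate. They
necessarily contain `x`, and `c ↦ c \ {x}` makes them correspond to the sets which dominate all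
vertices but `x`. -/
def criticalSets (x : W) : Set {D : Set W // G.IsDominatingSet D} :=
  {c | undominated G (c.1 \ {x}) = {x}}

theorem mem_of_mem_criticalSets {x : W} {c : {D : Set W // G.IsDominatingSet D}}
    (hc : c ∈ criticalSets G x) : x ∈ c.1 := by
  by_contra hx
  have hempty := isDominatingSet_iff_undominated_eq_empty.1 c.2
  rw [criticalSets, Set.mem_ofPred_eq, Set.sdiff_singleton_eq_self hx, hempty] at hc
  exact Set.singleton_ne_empty x hc.symm

theorem exists_mem_criticalSets {x : W} {E : Set W} (h : undominated G E = {x}) :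
    ∃ c ∈ criticalSets G x, c.1 \ {x} = E := by
  have hx : x ∉ E := (h.ge rfl : x ∈ undominated G E).1
  have hsdiff : insert x E \ {x} = E := Set.insert_sdiff_self_of_notMem hx
  refine ⟨⟨insert x E, fun w hw => ?_⟩, ?_, hsdiff⟩
  · obtain ⟨hwx, hwE⟩ := not_or.1 hw
    by_contra! hadj
    exact hwx (h.le ⟨hwE, fun d hd => hadj d (.inr hd)⟩)
  · rwa [criticalSets, Set.mem_ofPred_eq, hsdiff]

theorem card_dominatingSet_ne_two (G : SimpleGraph W) :
    Nat.card {D : Set W // G.IsDominatingSet D} ≠ 2 := by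
  intro hcard
  let univ' : {D : Set W // G.IsDominatingSet D} := ⟨.univ, fun w hw => (hw trivial).elim⟩
  obtain ⟨⟨D, hD⟩, hne, honly⟩ := Nat.card_eq_two_iff' univ' |>.1 hcard
  have eq_of_adj : ∀ {a b}, G.Adj a b → {a}ᶜ = D := fun {a b} hab => by
    have hdom : G.IsDominatingSet {a}ᶜ := fun y hy => by
      obtain rfl : y = a := by simpa using hy
      exact ⟨b, hab.ne', hab⟩
    have hne' : (⟨{a}ᶜ, hdom⟩ : {D : Set W // G.IsDominatingSet D}) ≠ univ' := fun h => by
      simpa [univ'] using congrArg Subtype.val h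
    exact congrArg Subtype.val (honly _ hne')
  obtain ⟨a, ha⟩ : ∃ a, a ∉ D := by
    by_contra! hall
    exact hne (Subtype.ext (Set.eq_univ_of_forall hall))
  obtain ⟨b, -, hab⟩ := hD a ha
  exact hab.ne (by simpa using (eq_of_adj hab).trans (eq_of_adj hab.symm).symm)

end Domination

/-- `H` arises from `H'`, embedded by `j`, by attaching the path `x - u - v` at the vertex `x`. -/
structure IsPendantPath {V W : Type*} {H : SimpleGraph V} {H' : SimpleGraph W} (j : H' ↪g H)
    (u v : V) (x : W) : Prop where
  range_eq : Set.range j = {u, v}ᶜ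
  neighborSet_u : H.neighborSet u = {j x, v}
  neighborSet_v : H.neighborSet v = {u}

theorem exists_isPendantPath {V W : Type*} {H : SimpleGraph V} {H' : SimpleGraph W}
    (h : H.IsOperationA H') : ∃ (j : H' ↪g H) (u v : V) (x : W), IsPendantPath j u v x := by
  obtain ⟨u, v, x, hxv, hu, hv, ⟨e⟩⟩ := h
  let j : H' ↪g H := (Embedding.induce _).comp e.toEmbedding
  have hrange : Set.range j = {u, v}ᶜ := by
    rw [show ⇑j = Subtype.val ∘ e from rfl, e.surjective.range_comp, Subtype.range_coe]
  have hux : H.Adj u x := by simp [← mem_neighborSet, hu]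
  obtain ⟨x, rfl⟩ : x ∈ Set.range j := by simp [hrange, hux.ne', hxv]
  exact ⟨j, u, v, x, hrange, hu, hv⟩

/-- The subsets of the path `u - v` that dominate `v`, with the two that contain `u` as the sides of
the triangle in an expansion, and `{v}` as the apex. -/
def pathTrace {V : Type*} (u v : V) : Option Bool → Set V
  | some true => {u, v}
  | some false => {u}
  | none => {v}

/-- The set of vertices that meets the embedded graph in `E` and the path `u - v` in the trace
indexed by `k`. -/
def pendantSet {V W : Type*} {H : SimpleGraph V} {H' : SimpleGraph W} (j : H' ↪g H) (u v : V)
    (E : Set W) (k : Option Bool) : Set V :=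
  j '' E ∪ pathTrace u v k

namespace IsPendantPath

variable {V W : Type*} {H : SimpleGraph V} {H' : SimpleGraph W} {j : H' ↪g H} {u v : V} {x : W}
  (h : IsPendantPath j u v x)
include h

theorem adj_u_iff {y : V} : H.Adj u y ↔ y = j x ∨ y = v := by
  simp [← mem_neighborSet, h.neighborSet_u]

theorem adj_v_iff {y : V} : H.Adj v y ↔ y = u := by
  simp [← mem_neighborSet, h.neighborSet_v]

theorem adj_u_v : H.Adj u v :=
  h.adj_u_iff.2 (.inr rfl)

theorem ne_u (w : W) : j w ≠ u := fun hw =>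
  (h.range_eq.le ⟨w, rfl⟩) (.inl hw)

theorem ne_v (w : W) : j w ≠ v := fun hw =>
  (h.range_eq.le ⟨w, rfl⟩) (.inr hw)

theorem eq_or_eq_or_exists (y : V) : y = u ∨ y = v ∨ ∃ w, y = j w := by
  by_cases hy : y = u ∨ y = v
  · tauto
  · obtain ⟨w, rfl⟩ : y ∈ Set.range j := h.range_eq.ge hy
    exact .inr (.inr ⟨w, rfl⟩)

theorem disjoint_image_pathTrace (E : Set W) (k : Option Bool) :
    Disjoint (j '' E) (pathTrace u v k) := by
  rw [Set.disjoint_left]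
  rintro _ ⟨w, -, rfl⟩
  rcases k with _ | _ | _ <;> simp [pathTrace, h.ne_u, h.ne_v]

theorem mem_pendantSet {E : Set W} {k : Option Bool} {w : W} :
    j w ∈ pendantSet j u v E k ↔ w ∈ E := by
  rcases k with _ | _ | _ <;> simp [pendantSet, pathTrace, h.ne_u, h.ne_v]

theorem u_mem_pendantSet {E : Set W} {k : Option Bool} :
    u ∈ pendantSet j u v E k ↔ k ≠ none := by
  rcases k with _ | _ | _ <;> simp [pendantSet, pathTrace, h.ne_u, h.adj_u_v.ne]

theorem v_mem_pendantSet {E : Set W} {k : Option Bool} :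
    v ∈ pendantSet j u v E k ↔ k ≠ some false := by
  rcases k with _ | _ | _ <;> simp [pendantSet, pathTrace, h.ne_v, h.adj_u_v.ne']

theorem pendantSet_inj {E E' : Set W} {k k' : Option Bool} :
    pendantSet j u v E k = pendantSet j u v E' k' ↔ E = E' ∧ k = k' := by
  refine ⟨fun heq => ⟨?_, ?_⟩, fun ⟨hE, hk⟩ => hE ▸ hk ▸ rfl⟩
  · ext w
    rw [← h.mem_pendantSet (E := E) (k := k), heq, h.mem_pendantSet]
  · have hu := h.u_mem_pendantSet (E := E) (k := k)
    have hv := h.v_mem_pendantSet (E := E) (k := k)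
    rw [heq, h.u_mem_pendantSet] at hu
    rw [heq, h.v_mem_pendantSet] at hv
    rcases k with _ | _ | _ <;> rcases k' with _ | _ | _ <;> simp_all

theorem exists_pendantSet_eq {D : Set V} (hD : u ∈ D ∨ v ∈ D) :
    ∃ k, pendantSet j u v (j ⁻¹' D) k = D := by
  have of_iff : ∀ {k}, (u ∈ D ↔ k ≠ none) → (v ∈ D ↔ k ≠ some false) →
      pendantSet j u v (j ⁻¹' D) k = D := fun {k} hu hv => by
    ext y
    rcases h.eq_or_eq_or_exists y with rfl | rfl | ⟨w, rfl⟩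
    · rw [h.u_mem_pendantSet, hu]
    · rw [h.v_mem_pendantSet, hv]
    · exact h.mem_pendantSet
  by_cases hu : u ∈ D
  · by_cases hv : v ∈ D
    · exact ⟨some true, of_iff (by simpa) (by simpa)⟩
    · exact ⟨some false, of_iff (by simpa) (by simpa)⟩
  · exact ⟨none, of_iff (by simpa) (by simpa [hu] using hD)⟩

theorem isDominatingSet_iff {D : Set V} :
    H.IsDominatingSet D ↔
      (u ∈ D ∨ v ∈ D) ∧ undominated H' (j ⁻¹' D) ⊆ {w | w = x ∧ u ∈ D} := by
  constructor
  · refine fun hD => ⟨?_, fun w ⟨hwD, hw⟩ => ?_⟩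
    · by_contra! huv
      obtain ⟨d, hd, hvd⟩ := hD v huv.2
      exact huv.1 (h.adj_v_iff.1 hvd ▸ hd)
    · obtain ⟨d, hd, hwd⟩ := hD _ hwD
      rcases h.eq_or_eq_or_exists d with rfl | rfl | ⟨d, rfl⟩
      · exact ⟨by simpa [h.ne_v] using h.adj_u_iff.1 hwd.symm, hd⟩
      · exact (h.ne_u w (h.adj_v_iff.1 hwd.symm)).elim
      · exact (hw d hd (j.map_adj_iff.1 hwd)).elim
  · rintro ⟨huv, hsub⟩ y hy
    rcases h.eq_or_eq_or_exists y with rfl | rfl | ⟨w, rfl⟩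
    · exact ⟨v, huv.resolve_left hy, h.adj_u_v⟩
    · exact ⟨u, huv.resolve_right hy, h.adj_u_v.symm⟩
    · by_contra! hadj
      obtain ⟨rfl, hu⟩ := hsub ⟨hy, fun d hd hwd => hadj (j d) hd (j.map_adj_iff.2 hwd)⟩
      exact hadj u hu (h.adj_u_iff.2 (.inl rfl)).symm

theorem isDominatingSet_pendantSet_iff {E : Set W} {k : Option Bool} :
    H.IsDominatingSet (pendantSet j u v E k) ↔
      undominated H' E ⊆ {w | w = x ∧ k ≠ none} := by
  have hpre : j ⁻¹' (pendantSet j u v E k) = E := Set.ext fun _ => h.mem_pendantSet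
  rw [h.isDominatingSet_iff, hpre, h.u_mem_pendantSet, h.v_mem_pendantSet]
  refine and_iff_right ?_
  rcases k with _ | _ | _ <;> simp

theorem tarsMove_pendantSet_left {E E' : Set W} (hE : TarsMove H' E E') (k : Option Bool) :
    TarsMove H (pendantSet j u v E k) (pendantSet j u v E' k) :=
  (hE.image (f := j.toHom) j.injective).union_right (h.disjoint_image_pathTrace E k)
    (h.disjoint_image_pathTrace E' k)

theorem tarsMove_pendantSet_right (E : Set W) {k k' : Option Bool}
    (hk : TarsMove H (pathTrace u v k) (pathTrace u v k')) :
    TarsMove H (pendantSet j u v E k) (pendantSet j u v E k') := by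
  rw [pendantSet, pendantSet, Set.union_comm, Set.union_comm (j '' E)]
  exact hk.union_right (h.disjoint_image_pathTrace E k).symm
    (h.disjoint_image_pathTrace E k').symm

theorem tarsMove_pathTrace_sides :
    TarsMove H (pathTrace u v (some true)) (pathTrace u v (some false)) :=
  .inl (.inr ⟨v, .inr rfl, by simp [pathTrace, Set.pair_comm u, h.adj_u_v.ne']⟩)

theorem tarsMove_pathTrace_apex (s : Bool) :
    TarsMove H (pathTrace u v (some s)) (pathTrace u v none) := by
  have hu : u ∉ ({v} : Set V) := h.adj_u_v.ne
  have hsdiff : {v} = ({u, v} : Set V) \ {u} := (Set.insert_sdiff_self_of_notMem hu).symm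
  cases s
  · exact .inr ⟨u, v, rfl, ⟨rfl, h.adj_u_v.ne'⟩, h.adj_u_v, hsdiff⟩
  · exact .inl (.inr ⟨u, .inl rfl, hsdiff⟩)

theorem tokenSlide_u_x {E : Set W} (hx : x ∈ E) :
    H.TokenSlide (pendantSet j u v (E \ {x}) (some true)) (pendantSet j u v E none) := by
  refine ⟨u, j x, h.u_mem_pendantSet.2 (by simp),
    ⟨h.mem_pendantSet.2 hx, fun hx' => (h.mem_pendantSet.1 hx').2 rfl⟩,
    h.adj_u_iff.2 (.inl rfl), Set.ext fun y => ?_⟩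
  rcases h.eq_or_eq_or_exists y with rfl | rfl | ⟨w, rfl⟩
  · simp [h.u_mem_pendantSet]
  · simp [h.v_mem_pendantSet, h.adj_u_v.ne']
  · by_cases hw : w = x <;> simp [h.mem_pendantSet, h.ne_u, hw, hx]

/-- The dominating sets of `H`, indexed by the expansion of the TARS-graph of `H'`: those with a
dominating trace on `H'` form the triangles, and those whose trace dominates all but `x` form the
outer edges. -/
def toDominatingSet : Expansion (criticalSets H' x) → {D : Set V // H.IsDominatingSet D}
  | .inl (c, k) => ⟨pendantSet j u v c.1 k, h.isDominatingSet_pendantSet_iff.2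
      (by simp [isDominatingSet_iff_undominated_eq_empty.1 c.2])⟩
  | .inr (c, s) => ⟨pendantSet j u v (c.1.1 \ {x}) (some s), h.isDominatingSet_pendantSet_iff.2
      (by simp [show undominated H' (c.1.1 \ {x}) = {x} from c.2])⟩

theorem toDominatingSet_injective : Function.Injective h.toDominatingSet := by
  have ne_sdiff : ∀ (c : {D : Set W // H'.IsDominatingSet D}) (d : criticalSets H' x),
      c.1 ≠ d.1.1 \ {x} := fun c d hcd => by
    have hd : undominated H' (d.1.1 \ {x}) = {x} := d.2
    rw [← hcd, isDominatingSet_iff_undominated_eq_empty.1 c.2] at hd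
    exact Set.singleton_ne_empty x hd.symm
  rintro (⟨c, k⟩ | ⟨c, s⟩) (⟨d, k'⟩ | ⟨d, t⟩) heq <;>
    obtain ⟨hE, hk⟩ := h.pendantSet_inj.1 (congrArg Subtype.val heq)
  · rw [Subtype.ext hE, hk]
  · exact (ne_sdiff c d hE).elim
  · exact (ne_sdiff d c hE.symm).elim
  · have hcd : c.1.1 = d.1.1 := by
      rw [← Set.insert_sdiff_self_of_mem (mem_of_mem_criticalSets c.2), hE,
        Set.insert_sdiff_self_of_mem (mem_of_mem_criticalSets d.2)]
    rw [Subtype.ext (Subtype.ext hcd), Option.some.inj hk]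

theorem toDominatingSet_surjective : Function.Surjective h.toDominatingSet := by
  rintro ⟨D, hD⟩
  obtain ⟨k, hk⟩ := h.exists_pendantSet_eq (h.isDominatingSet_iff.1 hD).1
  generalize j ⁻¹' D = E at hk
  subst hk
  have hsub := h.isDominatingSet_pendantSet_iff.1 hD
  rcases Set.subset_singleton_iff_eq.1 (hsub.trans fun w hw => hw.1) with hE | hE
  · exact ⟨.inl (⟨E, isDominatingSet_iff_undominated_eq_empty.2 hE⟩, k), rfl⟩
  · obtain ⟨s, rfl⟩ := Option.ne_none_iff_exists'.1 (hsub (hE.ge rfl)).2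
    obtain ⟨c, hc, rfl⟩ := exists_mem_criticalSets hE
    exact ⟨.inr (⟨c, hc⟩, s), rfl⟩

theorem tarsGraph_adj_toDominatingSet {y z : Expansion (criticalSets H' x)}
    (hyz : Expansion.Rel H'.tarsGraph (criticalSets H' x) y z) :
    H.tarsGraph.Adj (h.toDominatingSet y) (h.toDominatingSet z) := by
  cases hyz with
  | sides c => exact h.tarsMove_pendantSet_right _ h.tarsMove_pathTrace_sides
  | apex c s => exact h.tarsMove_pendantSet_right _ (h.tarsMove_pathTrace_apex s)
  | layer hcd k => exact h.tarsMove_pendantSet_left hcd k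
  | outer c => exact h.tarsMove_pendantSet_right _ h.tarsMove_pathTrace_sides
  | outer_side c s =>
    exact h.tarsMove_pendantSet_left (.inl (.inr ⟨x, mem_of_mem_criticalSets c.2, rfl⟩)) _
  | outer_apex c => exact .inr (h.tokenSlide_u_x (mem_of_mem_criticalSets c.2))

end IsPendantPath

end TarsGraph

theorem mainTheorem3_general {V W : Type*} [Finite V] (H : SimpleGraph V) (H' : SimpleGraph W)
    (hop : H.IsOperationA H') (htrace : TarsGraph.IsHomogeneouslyTraceable H'.tarsGraph) :
    H.tarsGraph.IsPancyclic := by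
  obtain ⟨j, u, v, x, h⟩ := TarsGraph.exists_isPendantPath hop
  have : Finite W := Finite.of_injective j j.injective
  exact TarsGraph.isPancyclic_of_bijective
    (TarsGraph.Expansion.lift h.toDominatingSet h.tarsGraph_adj_toDominatingSet)
    ⟨h.toDominatingSet_injective, h.toDominatingSet_surjective⟩
    (TarsGraph.Expansion.isPancyclic_graph htrace)

theorem mainTheorem3 {V W : Type*} [Finite V] [Finite W]
    (H : SimpleGraph V) (H' : SimpleGraph W)
    (hconn : H'.Connected) (hcard : 2 ≤ Nat.card W)
    (hop : H.IsOperationA H')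
    (hpan : H'.tarsGraph.IsPancyclic) :
    H.tarsGraph.IsPancyclic :=
  mainTheorem3_general H H' hop
    (TarsGraph.isHomogeneouslyTraceable_of_isPancyclic hpan
      (TarsGraph.card_dominatingSet_ne_two H'))
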